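/- Let $\mathcal K$ be a finite complex obtained by gluing Euclidean triangles (and possibly edges) along edges and vertices, whose 1-skeleton has a planar drawing such that the 2-cells are exactly the inner faces of the drawing. Assume that $\mathcal K$ with its intrinsic metric $d$ (the infimum of the lengths of the paths that are piecewise straight in the cells) is a CAT(0) space, and write $\gamma(u,v)$ for the unique geodesic (shortest path) joining $u$ and $v$. Let $\partial\mathcal K$ be the union of the vertices and edges that lie in at most one triangle and, for a vertex $v$, let $\theta(v)$ be the sum of the angles at $v$ of the triangles incident to $v$; $v$ has negative curvature if $\theta(v)>2\pi$. For $u\in\mathcal K$ and points $v,w\in\partial\mathcal K\setminus\{u\}$ such that $\gamma(u,v)$ and $\gamma(u,w)$ form an (Alexandrov) angle $\alpha$ at $u$ with $0<\alpha<\pi$, the cone $\mathcal C(u;v,w)$ with apex $u$ and sides $\gamma(u,v)$, $\gamma(u,w)$ is the union of the two sides and of the region bounded by them that contains the angle $\alpha$, i.e. of the connected component of $\mathcal K\setminus(\gamma(u,v)\cup\gamma(u,w))$ whose points close to $u$ are exactly the points, off the sides and close to $u$, whose direction at $u$ lies in the angle $\alpha$ (a point $s$ lies in the angle if $\angle_u(v,s)+\angle_u(s,w)=\angle_u(v,w)$).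 The interior of a cone is the cone without its sides. Let $x\in\mathcal K$. A shortest path map SPM($x$) is a partition of $\mathcal K$ into cones (the cones cover $\mathcal K$, and different cones have disjoint interiors) such that: (1) for every vertex $y$ of $\mathcal K$ there is a point $p\in\partial\mathcal K$ with $y\in\gamma(x,p)$ such that (a) if $\theta(y)=2\pi$, then $y$ lies on the common side $\gamma(z,p)$, $\gamma(z',p)$ of two different cones $\mathcal C(z;p,q)$, $\mathcal C(z';p,r)$ of SPM($x$), i.e. $y\in\gamma(z,p)\cap\gamma(z',p)$; (b) if $y$ has negative curvature, then $y$ is the apex of at least one cone $\mathcal C(y;p,q)$ of SPM($x$); (2) for every cone $\mathcal C(z;p,q)$ of SPM($x$), the apex $z$ belongs to $\gamma(x,p)$ and to $\gamma(x,q)$. Then for every shortest path map SPM($x$) and every point $y$ of $\mathcal K$: the point $y$ lies in at least one cone of SPM($x$), and for every cone $\mathcal C(z;p,q)$ of SPM($x$) that contains $y$, the shortest path $\gamma(x,y)$ passes through the apex $z$. -/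

import Mathlib

open Set Filter Topology

noncomputable section

/-! ### Geodesics, CAT(0) spaces and angles

The intrinsic (length) distance of a complex takes values in `[0, ∞]`, so the metric notions are
stated for pseudo-extended metric spaces.  In a geodesic space all distances are finite and
distinct points have positive distance, so a CAT(0) space as defined below is a genuine metric
space. -/

/-- The distance as a real number. -/
def rdist {X : Type*} [PseudoEMetricSpace X] (x y : X) : ℝ := (edist x y).toReal

/-- `G` is a geodesic joining `x` and `y`: the image of a map `g : [0, l] → X` with `g 0 = x`,
`g l = y` and `d (g t) (g t') = |t - t'|`. -/
def IsGeodesic {X : Type*} [PseudoEMetricSpace X] (x y : X) (G : Set X) : Prop :=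
  ∃ (l : ℝ) (g : ℝ → X), 0 ≤ l ∧ g 0 = x ∧ g l = y ∧
    (∀ t ∈ Icc 0 l, ∀ t' ∈ Icc 0 l, edist (g t) (g t') = ENNReal.ofReal |t - t'|) ∧
    G = g '' Icc 0 l

/-- The set of points on a geodesic from `x` to `y`.  In a CAT(0) space the geodesic is unique,
and this set is the geodesic segment `γ(x, y)`. -/
def geodSeg {X : Type*} [PseudoEMetricSpace X] (x y : X) : Set X :=
  ⋃₀ {G | IsGeodesic x y G}

/-- CAT(0) spaces: geodesic spaces whose geodesic triangles satisfy the comparison axiom of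
Cartan, Alexandrov and Toponogov with respect to comparison triangles in the Euclidean plane. -/
structure IsCAT0 (X : Type*) [PseudoEMetricSpace X] : Prop where
  geodesic : ∀ x y : X, ∃ G, IsGeodesic x y G
  comparison : ∀ (x₁ x₂ x₃ : X), x₁ ≠ x₂ → x₂ ≠ x₃ → x₁ ≠ x₃ →
    ∀ G, IsGeodesic x₁ x₂ G → ∀ y ∈ G,
    ∀ (x₁' x₂' x₃' y' : EuclideanSpace ℝ (Fin 2)),
      dist x₁' x₂' = rdist x₁ x₂ → dist x₂' x₃' = rdist x₂ x₃ → dist x₁' x₃' = rdist x₁ x₃ →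
      y' ∈ segment ℝ x₁' x₂' → dist x₁' y' = rdist x₁ y → dist x₂' y' = rdist x₂ y →
      rdist x₃ y ≤ dist x₃' y'

/-- The Euclidean comparison angle at `u` of the triangle `u, r, s` (law of cosines). -/
def compAngle {X : Type*} [PseudoEMetricSpace X] (u r s : X) : ℝ :=
  Real.arccos ((rdist u r ^ 2 + rdist u s ^ 2 - rdist r s ^ 2) / (2 * rdist u r * rdist u s))

/-- The Alexandrov angle `∠_u(v, w)` between the geodesics `γ(u, v)` and `γ(u, w)` (for `v, w ≠ u`):
the upper limit of the comparison angles at `u` of `u, r, s`, where `r ∈ γ(u, v)` and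
`s ∈ γ(u, w)` tend to `u`. -/
def alexAngle {X : Type*} [PseudoEMetricSpace X] (u v w : X) : ℝ :=
  limsup (fun rs : X × X => compAngle u rs.1 rs.2)
    (𝓝[geodSeg u v \ {u}] u ×ˢ 𝓝[geodSeg u w \ {u}] u)

/-! ### Piecewise Euclidean triangular complexes -/

/-- A finite piecewise Euclidean complex of dimension at most two all of whose 2-cells are
Euclidean triangles, given by its vertices, edges and triangles and by the edge lengths. -/
structure TriComplex (V : Type*) [Fintype V] [DecidableEq V] extends
    AbstractSimplicialComplex V where
  card_le : ∀ s ∈ faces, s.card ≤ 3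
  len : V → V → ℝ
  len_self : ∀ a, len a a = 0
  len_symm : ∀ a b, len a b = len b a
  len_pos : ∀ a b, a ≠ b → {a, b} ∈ faces → 0 < len a b
  len_triangle : ∀ a b c, a ≠ b → b ≠ c → a ≠ c → {a, b, c} ∈ faces →
    len a b < len a c + len c b

namespace TriComplex

variable {V : Type*} [Fintype V] [DecidableEq V]

/-- The points of the complex, in barycentric coordinates. -/
@[ext]
structure Point (K : TriComplex V) where
  coord : V → ℝ
  nonneg : ∀ v, 0 ≤ coord v
  sum_eq_one : ∑ v, coord v = 1
  support_mem : Finset.univ.filter (fun v => coord v ≠ 0) ∈ K.faces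

variable {K : TriComplex V}

/-- The vertices of the unique cell that contains `p` in its relative interior. -/
def Point.supp (p : K.Point) : Finset V := Finset.univ.filter (fun v => p.coord v ≠ 0)

/-- The (closed) cell with vertex set `s`. -/
def cell (K : TriComplex V) (s : Finset V) : Set K.Point := {p | p.supp ⊆ s}

/-- The relatively open cell with vertex set `s`. -/
def openCell (K : TriComplex V) (s : Finset V) : Set K.Point := {p | p.supp = s}

/-- The point of `K` given by a vertex. -/
def vert (K : TriComplex V) (v : V) : K.Point where
  coord := fun w => if w = v then 1 else 0
  nonneg := fun w => by split_ifs <;> norm_num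
  sum_eq_one := by simp
  support_mem := by
    have h : Finset.univ.filter (fun w => (if w = v then (1 : ℝ) else 0) ≠ 0) = {v} := by
      ext w; simp
    rw [h]
    exact K.singleton_mem v

/-- The Euclidean distance of two points of a common cell: if the vertices `P v` of a Euclidean
simplex have distances `len`, then
`‖∑ v, (p v - q v) • P v‖ ^ 2 = - (1 / 2) * ∑ v, ∑ w, len v w ^ 2 * (p v - q v) * (p w - q w)`. -/
def cellDist (p q : K.Point) : ℝ :=
  √(-(1 / 2) * ∑ v, ∑ w, K.len v w ^ 2 * (p.coord v - q.coord v) * (p.coord w - q.coord w))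

/-- `c 0, c 1, …, c n` is a path from `x` to `y`: consecutive points lie in a common cell. -/
def IsPath (x y : K.Point) (n : ℕ) (c : ℕ → K.Point) : Prop :=
  c 0 = x ∧ c n = y ∧ ∀ i < n, ∃ s ∈ K.faces, c i ∈ K.cell s ∧ c (i + 1) ∈ K.cell s

/-- The length of the path `c 0, c 1, …, c n`. -/
def pathLength (n : ℕ) (c : ℕ → K.Point) : ENNReal :=
  ∑ i ∈ Finset.range n, ENNReal.ofReal (cellDist (c i) (c (i + 1)))

/-- The intrinsic distance: the infimum of the lengths of the paths joining `x` and `y`. -/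
def intrinsicDist (x y : K.Point) : ENNReal :=
  ⨅ (n : ℕ) (c : ℕ → K.Point) (_ : IsPath x y n c), pathLength n c

theorem cellDist_comm (p q : K.Point) : cellDist p q = cellDist q p := by
  unfold cellDist
  congr 2
  refine Finset.sum_congr rfl fun v _ => Finset.sum_congr rfl fun w _ => ?_
  ring

theorem intrinsicDist_self (x : K.Point) : intrinsicDist x x = 0 := by
  refine le_antisymm ?_ bot_le
  refine iInf_le_of_le 0 (iInf_le_of_le (fun _ => x) (iInf_le_of_le ⟨rfl, rfl, ?_⟩ ?_))
  · intro i hi; omega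
  · simp [pathLength]

theorem intrinsicDist_le_symm (x y : K.Point) : intrinsicDist x y ≤ intrinsicDist y x := by
  refine le_iInf fun n => le_iInf fun c => le_iInf fun hc => ?_
  obtain ⟨h0, hn, h⟩ := hc
  refine iInf_le_of_le n (iInf_le_of_le (fun i => c (n - i)) (iInf_le_of_le ⟨?_, ?_, ?_⟩ ?_))
  · simpa using hn
  · simpa using h0
  · intro i hi
    obtain ⟨s, hs, h1, h2⟩ := h (n - (i + 1)) (by omega)
    refine ⟨s, hs, ?_, h1⟩
    rwa [show n - (i + 1) + 1 = n - i by omega] at h2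
  · unfold pathLength
    rw [← Finset.sum_range_reflect (fun i => ENNReal.ofReal (cellDist (c i) (c (i + 1)))) n]
    refine le_of_eq (Finset.sum_congr rfl fun i hi => ?_)
    have hi' : i < n := Finset.mem_range.mp hi
    rw [show n - 1 - i = n - (i + 1) by omega, show n - (i + 1) + 1 = n - i by omega,
      cellDist_comm]

theorem intrinsicDist_triangle (x y z : K.Point) :
    intrinsicDist x z ≤ intrinsicDist x y + intrinsicDist y z := by
  have key : ∀ (m : ℕ) (b : ℕ → K.Point), IsPath x y m b → ∀ (n : ℕ) (c : ℕ → K.Point),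
      IsPath y z n c → intrinsicDist x z ≤ pathLength m b + pathLength n c := by
    rintro m b ⟨hb0, hbm, hb⟩ n c ⟨hc0, hcn, hc⟩
    set e : ℕ → K.Point := fun i => if i < m then b i else c (i - m) with he
    have e1 : ∀ i ≤ m, e i = b i := by
      intro i hi
      rcases hi.lt_or_eq with h | rfl
      · simp [he, h]
      · simp [he, hc0, hbm]
    have e2 : ∀ i, e (m + i) = c i := by
      intro i
      simp [he]
    refine iInf_le_of_le (m + n) (iInf_le_of_le e (iInf_le_of_le ⟨?_, ?_, ?_⟩ ?_))
    · rw [e1 0 (Nat.zero_le _), hb0]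
    · rw [e2, hcn]
    · intro i hi
      by_cases h : i < m
      · rw [e1 i h.le, e1 (i + 1) h]
        exact hb i h
      · obtain ⟨j, rfl⟩ := Nat.exists_eq_add_of_le (not_lt.mp h)
        rw [e2, add_assoc, e2]
        exact hc j (by omega)
    · unfold pathLength
      rw [Finset.sum_range_add]
      refine le_of_eq (congrArg₂ _ (Finset.sum_congr rfl fun i hi => ?_)
        (Finset.sum_congr rfl fun i _ => ?_))
      · have h : i < m := Finset.mem_range.mp hi
        rw [e1 i h.le, e1 (i + 1) h]
      · rw [e2, add_assoc, e2]
  conv_rhs => unfold intrinsicDist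
  simp only [ENNReal.iInf_add, ENNReal.add_iInf]
  exact le_iInf fun m => le_iInf fun b => le_iInf fun hb => le_iInf fun n => le_iInf fun c =>
    le_iInf fun hc => by first | exact key m b hb n c hc | exact key n c hc m b hb

instance (K : TriComplex V) : PseudoEMetricSpace K.Point where
  edist := intrinsicDist
  edist_self := intrinsicDist_self
  edist_comm x y := le_antisymm (intrinsicDist_le_symm x y) (intrinsicDist_le_symm y x)
  edist_triangle := intrinsicDist_triangle

/-- The 1-skeleton of the complex: the union of its vertices and edges. -/
def skeleton (K : TriComplex V) : Set K.Point := {p | p.supp.card ≤ 2}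

/-- Planarity: the 1-skeleton has a planar drawing such that the (open) 2-cells of the complex are
exactly the inner faces, i.e. the bounded components of the complement of the drawing. -/
def IsPlanar (K : TriComplex V) : Prop :=
  ∃ φ : K.Point → EuclideanSpace ℝ (Fin 2), Continuous φ ∧ Function.Injective φ ∧
    {F : Set (EuclideanSpace ℝ (Fin 2)) | Bornology.IsBounded F ∧
      ∃ P ∈ (φ '' K.skeleton)ᶜ, F = connectedComponentIn (φ '' K.skeleton)ᶜ P} =
    {F | ∃ s ∈ K.faces, s.card = 3 ∧ F = φ '' K.openCell s}

/-- The boundary `∂K`: the union of the cells of dimension at most one that lie in at most one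
2-cell. -/
def boundary (K : TriComplex V) : Set K.Point :=
  {p | ∃ e ∈ K.faces, e.card ≤ 2 ∧ p ∈ K.cell e ∧
    {t | t ∈ K.faces ∧ t.card = 3 ∧ e ⊆ t}.Subsingleton}

/-- The angle at the vertex `v` of the Euclidean triangle with vertices `v, a, b`. -/
def faceAngle (K : TriComplex V) (v a b : V) : ℝ :=
  Real.arccos ((K.len v a ^ 2 + K.len v b ^ 2 - K.len a b ^ 2) / (2 * K.len v a * K.len v b))

open Classical in
/-- `θ(v)`: the sum of the angles at `v` of the triangles of `K` incident to `v` (every triangle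
`{v, a, b}` is counted twice in the double sum). -/
def theta (K : TriComplex V) (v : V) : ℝ :=
  (1 / 2) * ∑ a, ∑ b,
    if v ≠ a ∧ v ≠ b ∧ a ≠ b ∧ ({v, a, b} : Finset V) ∈ K.faces then K.faceAngle v a b else 0

/-! ### Cones -/

/-- `u, v, w` determine a cone `C(u; v, w)` of `K`: `v` and `w` are boundary points different
from `u`, and the geodesics `γ(u, v)` and `γ(u, w)` form an angle `α` with `0 < α < π`. -/
def IsCone (K : TriComplex V) (u v w : K.Point) : Prop :=
  v ∈ K.boundary ∧ w ∈ K.boundary ∧ v ≠ u ∧ w ≠ u ∧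
    0 < alexAngle u v w ∧ alexAngle u v w < Real.pi

/-- The union of the two sides of the cone `C(u; v, w)`. -/
def coneSides (K : TriComplex V) (u v w : K.Point) : Set K.Point := geodSeg u v ∪ geodSeg u w

/-- The direction at `u` of the point `s` lies in the angle formed by `γ(u, v)` and `γ(u, w)`. -/
def InAngle (u v w s : K.Point) : Prop := alexAngle u v s + alexAngle u s w = alexAngle u v w

/-- The region bounded by `γ(u, v)` and `γ(u, w)` which contains the angle `α < π` they form: the
connected component of the complement of the two sides which, near `u`, consists exactly of the
points whose direction lies in that angle. -/
def coneRegion (K : TriComplex V) (u v w : K.Point) : Set K.Point :=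
  {y | y ∈ (K.coneSides u v w)ᶜ ∧ ∃ ε > 0, ∀ s ∈ (K.coneSides u v w)ᶜ, edist u s < ε →
    (s ∈ connectedComponentIn (K.coneSides u v w)ᶜ y ↔ InAngle u v w s)}

/-- The cone `C(u; v, w)` with apex `u`: the region bounded by the sides which contains the angle
formed by them, together with the sides. -/
def cone (K : TriComplex V) (u v w : K.Point) : Set K.Point :=
  K.coneRegion u v w ∪ K.coneSides u v w

/-- The interior of a cone: the cone without its sides. -/
def coneInt (K : TriComplex V) (u v w : K.Point) : Set K.Point :=
  K.cone u v w \ K.coneSides u v w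

/-! ### Shortest path maps -/

/-- The family `S` of triples `(z, p, q)`, standing for the cones `C(z; p, q)`, is a shortest path
map SPM(`x`) of `K` with origin `x`. -/
structure IsSPM (K : TriComplex V) (x : K.Point) (S : Set (K.Point × K.Point × K.Point)) :
    Prop where
  isCone : ∀ z p q, (z, p, q) ∈ S → K.IsCone z p q
  /-- `C(z; p, q)` and `C(z; q, p)` denote the same cone. -/
  symm : ∀ z p q, (z, p, q) ∈ S → (z, q, p) ∈ S
  /-- The cones form a partition of `K`: they cover `K` and different cones have disjoint
  interiors. -/
  cover : ∀ y, ∃ z p q, (z, p, q) ∈ S ∧ y ∈ K.cone z p q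
  disjoint : ∀ z p q z' p' q', (z, p, q) ∈ S → (z', p', q') ∈ S →
    K.cone z p q ≠ K.cone z' p' q' → Disjoint (K.coneInt z p q) (K.coneInt z' p' q')
  /-- Through every vertex `y` passes a geodesic `γ(x, p)` with `p ∈ ∂K` such that: if
  `θ(y) = 2π`, then `y` lies on the common side (ending in `p`) of two different cones; if `y`
  is a vertex of negative curvature, then `y` is the apex of a cone `C(y; p, q)`. -/
  vertex : ∀ y : V, ∃ p ∈ K.boundary, K.vert y ∈ geodSeg x p ∧
    (K.theta y = 2 * Real.pi → ∃ z q z' r, (z, p, q) ∈ S ∧ (z', p, r) ∈ S ∧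
      K.cone z p q ≠ K.cone z' p r ∧ K.vert y ∈ geodSeg z p ∩ geodSeg z' p) ∧
    (2 * Real.pi < K.theta y → ∃ q, (K.vert y, p, q) ∈ S)
  /-- The apex of a cone `C(z; p, q)` lies on the geodesics `γ(x, p)` and `γ(x, q)`. -/
  apex_mem : ∀ z p q, (z, p, q) ∈ S → z ∈ geodSeg x p ∧ z ∈ geodSeg x q

end TriComplex

end

/-!
Let `y` lie in the cone with apex `z` and sides `γ(z, p)`, `γ(z, q)`, where `z ∈ γ(x, p)` and
`z ∈ γ(x, q)`.

If `γ(x, y)` meets a side, say `γ(z, p)`, in a point `s`, then `d(x, s) = d(x, z) + d(z, s)`, because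
`z` and `s` occur in this order on a geodesic from `x` to `p`; as geodesics of a CAT(0) space are
unique, `γ(x, y)` passes through `z` (`IsCAT0.mem_of_rdist_add_eq`).

Otherwise `γ(x, y)` misses the sides, so `x` lies in the region of the cone. No point of `γ(z, x)`
other than `z` lies on a side, hence `γ(z, x) \ {z}` is contained in the region, and the direction
at `z` of a point `s` of it near `z` lies in the angle `∠_z(p, q)`. But `γ(z, s)` prolongs both sides
beyond `z`, so `∠_z(p, s) = ∠_z(s, q) = π` (`alexAngle_eq_pi`), whereas `∠_z(p, q) < π`.
-/

section Geodesics

variable {X : Type*} [PseudoEMetricSpace X]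

theorem rdist_comm (x y : X) : rdist x y = rdist y x := by
  unfold rdist; rw [edist_comm]

theorem rdist_self (x : X) : rdist x x = 0 := by simp [rdist]

theorem rdist_nonneg (x y : X) : 0 ≤ rdist x y := ENNReal.toReal_nonneg

theorem rdist_add_rdist_of_mem_geodSeg {x y s : X} (h : s ∈ geodSeg x y) :
    rdist x s + rdist s y = rdist x y := by
  obtain ⟨G, ⟨l, g, hl, rfl, rfl, hg, rfl⟩, t, ht, rfl⟩ := h
  have h0 : (0 : ℝ) ∈ Icc 0 l := ⟨le_rfl, hl⟩
  have h1 : l ∈ Icc 0 l := ⟨hl, le_rfl⟩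
  simp only [rdist, hg 0 h0 t ht, hg t ht l h1, hg 0 h0 l h1, ENNReal.toReal_ofReal (abs_nonneg _)]
  rw [abs_of_nonpos (by linarith [ht.1]), abs_of_nonpos (by linarith [ht.2]),
    abs_of_nonpos (by linarith)]
  ring

theorem continuousOn_of_edist_eq {g : ℝ → X} {l : ℝ}
    (hg : ∀ t ∈ Icc 0 l, ∀ t' ∈ Icc 0 l, edist (g t) (g t') = ENNReal.ofReal |t - t'|) :
    ContinuousOn g (Icc 0 l) := by
  have : LipschitzOnWith 1 g (Icc 0 l) := by
    intro t ht t' ht'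
    rw [hg t ht t' ht', edist_dist, Real.dist_eq]
    simp
  exact this.continuousOn

namespace IsCAT0

theorem edist_ne_top (hX : IsCAT0 X) (x y : X) : edist x y ≠ ⊤ := by
  obtain ⟨G, l, g, hl, rfl, rfl, hg, -⟩ := hX.geodesic x y
  rw [hg 0 ⟨le_rfl, hl⟩ l ⟨hl, le_rfl⟩]
  exact ENNReal.ofReal_ne_top

theorem eq_of_rdist_eq_zero (hX : IsCAT0 X) {x y : X} (h : rdist x y = 0) : x = y := by
  obtain ⟨G, l, g, hl, rfl, rfl, hg, -⟩ := hX.geodesic x y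
  rw [rdist, hg 0 ⟨le_rfl, hl⟩ l ⟨hl, le_rfl⟩, ENNReal.toReal_ofReal (abs_nonneg _)] at h
  have : l = 0 := by simpa using h
  rw [this]

theorem rdist_pos (hX : IsCAT0 X) {x y : X} (h : x ≠ y) : 0 < rdist x y :=
  (rdist_nonneg x y).lt_of_ne fun h0 => h (hX.eq_of_rdist_eq_zero h0.symm)

theorem rdist_triangle (hX : IsCAT0 X) (x y z : X) : rdist x z ≤ rdist x y + rdist y z := by
  unfold rdist
  rw [← ENNReal.toReal_add (hX.edist_ne_top _ _) (hX.edist_ne_top _ _)]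
  exact ENNReal.toReal_mono (ENNReal.add_ne_top.2 ⟨hX.edist_ne_top _ _, hX.edist_ne_top _ _⟩)
    (edist_triangle x y z)

/-- A point between `x` and `s` lies on every geodesic that joins `x` to `s` or prolongs such a
geodesic. This is the uniqueness of geodesics, obtained from the comparison axiom for a degenerate
triangle. -/
theorem mem_of_rdist_add_eq (hX : IsCAT0 X) {x y z s : X} {G : Set X} (hG : IsGeodesic x y G)
    (hs : s ∈ G) (h : rdist x z + rdist z s = rdist x s) : z ∈ G := by
  obtain ⟨l, g, hl, rfl, rfl, hg, rfl⟩ := hG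
  obtain ⟨t, ht, rfl⟩ := hs
  have hr : ∀ a ∈ Icc 0 l, ∀ b ∈ Icc 0 l, rdist (g a) (g b) = |a - b| := fun a ha b hb => by
    rw [rdist, hg a ha b hb, ENNReal.toReal_ofReal (abs_nonneg _)]
  have h0 : (0 : ℝ) ∈ Icc 0 l := ⟨le_rfl, hl⟩
  have hxs : rdist (g 0) (g t) = t := by
    rw [hr 0 h0 t ht, zero_sub, abs_neg, abs_of_nonneg ht.1]
  by_cases hxz : g 0 = z
  · exact ⟨0, h0, hxz⟩
  by_cases hzs : g t = z
  · exact ⟨t, ht, hzs⟩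
  set a := rdist (g 0) z with ha
  have ha0 : 0 < a := hX.rdist_pos hxz
  have hb : rdist z (g t) = t - a := by linarith
  have hb0 : 0 < t - a := hb ▸ hX.rdist_pos (Ne.symm hzs)
  have hxne : g 0 ≠ g t := fun h' => by
    rw [h', rdist_self] at hxs
    linarith
  have hat : a ∈ Icc 0 l := ⟨ha0.le, by linarith [ht.2]⟩
  have hxa : rdist (g 0) (g a) = a := by
    rw [hr 0 h0 a hat, zero_sub, abs_neg, abs_of_pos ha0]
  have hsa : rdist (g t) (g a) = t - a := by rw [hr t ht a hat, abs_of_pos hb0]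
  have hG : IsGeodesic (g 0) (g t) (g '' Icc 0 t) :=
    ⟨t, g, ht.1, rfl, rfl, fun u hu v hv =>
      hg u ⟨hu.1, hu.2.trans ht.2⟩ v ⟨hv.1, hv.2.trans ht.2⟩, rfl⟩
  -- The comparison triangle is degenerate: its vertices are at `0`, `t` and `a` on a line.
  let e : ℝ → EuclideanSpace ℝ (Fin 2) := fun r => r • EuclideanSpace.single 0 1
  have he : ∀ r r', dist (e r) (e r') = |r - r'| := fun r r' => by
    rw [dist_eq_norm, ← sub_smul, norm_smul]
    simp
  have key := hX.comparison (g 0) (g t) z hxne hzs hxz _ hG (g a)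
    ⟨a, ⟨ha0.le, by linarith⟩, rfl⟩ (e 0) (e t) (e a) (e a)
    (by rw [he, hxs, zero_sub, abs_neg, abs_of_nonneg ht.1])
    (by rw [he, rdist_comm, hb, abs_of_pos hb0])
    (by rw [he, zero_sub, abs_neg, abs_of_pos ha0])
    ⟨1 - a / t, a / t, by rw [sub_nonneg, div_le_one (by linarith)]; linarith,
      div_nonneg ha0.le ht.1, by ring, by
        simp only [e, zero_smul, smul_zero, zero_add, smul_smul]
        rw [div_mul_cancel₀ _ (by linarith)]⟩
    (by rw [he, hxa, zero_sub, abs_neg, abs_of_pos ha0])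
    (by rw [he, hsa, abs_of_pos hb0])
  rw [dist_self] at key
  exact ⟨a, hat, (hX.eq_of_rdist_eq_zero (le_antisymm key (rdist_nonneg _ _))).symm⟩

/-- If `z` lies on a geodesic from `x` to `p`, then every point of a geodesic from `x` to `z` and
every point of a geodesic from `z` to `p` have `z` between them. -/
theorem rdist_add_eq_of_mem (hX : IsCAT0 X) {x z p s r : X} (hz : z ∈ geodSeg x p)
    (hs : rdist x s + rdist s z = rdist x z) (hr : r ∈ geodSeg z p) :
    rdist s z + rdist z r = rdist s r := by
  have h1 := rdist_add_rdist_of_mem_geodSeg hz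
  have h2 := rdist_add_rdist_of_mem_geodSeg hr
  have h3 := hX.rdist_triangle x s p
  have h4 := hX.rdist_triangle s r p
  have h5 := hX.rdist_triangle s z r
  linarith

theorem nhdsWithin_geodSeg_neBot (hX : IsCAT0 X) {u v : X} (h : v ≠ u) :
    (𝓝[geodSeg u v \ {u}] u).NeBot := by
  obtain ⟨G, hG⟩ := hX.geodesic u v
  obtain ⟨l, g, hl, rfl, rfl, hg, rfl⟩ := id hG
  have hl0 : 0 < l := hl.lt_of_ne fun h' => h (by rw [← h'])
  rw [← mem_closure_iff_nhdsWithin_neBot, EMetric.mem_closure_iff]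
  intro ε hε
  obtain ⟨δ, hδ, hδε⟩ : ∃ δ : ℝ, 0 < δ ∧ ENNReal.ofReal δ < ε := by
    obtain ⟨δ, h1, h2⟩ := ENNReal.lt_iff_exists_nnreal_btwn.1 hε
    exact ⟨δ, by exact_mod_cast h1, by simpa using h2⟩
  have hm0 : 0 < min δ l := lt_min hδ hl0
  have hm : min δ l ∈ Icc 0 l := ⟨hm0.le, min_le_right _ _⟩
  have hd : edist (g 0) (g (min δ l)) = ENNReal.ofReal (min δ l) := by
    rw [hg 0 ⟨le_rfl, hl⟩ _ hm, zero_sub, abs_neg, abs_of_pos hm0]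
  refine ⟨g (min δ l), ⟨⟨_, hG, _, hm, rfl⟩, fun h' => ?_⟩, ?_⟩
  · rw [mem_singleton_iff.1 h', edist_self] at hd
    exact (ENNReal.ofReal_pos.2 hm0).ne hd
  · rw [hd]
    exact (ENNReal.ofReal_le_ofReal (min_le_left _ _)).trans_lt hδε

/-- Geodesics that together form a geodesic through `u` make the angle `π` at `u`. -/
theorem alexAngle_eq_pi (hX : IsCAT0 X) {u v w : X} (hv : v ≠ u) (hw : w ≠ u)
    (h : ∀ r ∈ geodSeg u v, ∀ s ∈ geodSeg u w, rdist r s = rdist u r + rdist u s) :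
    alexAngle u v w = Real.pi := by
  have := hX.nhdsWithin_geodSeg_neBot hv
  have := hX.nhdsWithin_geodSeg_neBot hw
  have hev : (fun rs : X × X => compAngle u rs.1 rs.2)
      =ᶠ[𝓝[geodSeg u v \ {u}] u ×ˢ 𝓝[geodSeg u w \ {u}] u] fun _ => Real.pi := by
    filter_upwards [prod_mem_prod self_mem_nhdsWithin self_mem_nhdsWithin]
    rintro ⟨r, s⟩ ⟨⟨hr, hru⟩, hs, hsu⟩
    have hr0 : 0 < rdist u r := hX.rdist_pos (Ne.symm hru)
    have hs0 : 0 < rdist u s := hX.rdist_pos (Ne.symm hsu)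
    simp only [compAngle, h r hr s hs]
    rw [← Real.arccos_neg_one]
    congr 1
    field_simp
    ring
  rw [alexAngle, limsup_congr hev, limsup_const]

end IsCAT0

end Geodesics

namespace TriComplex

variable {V : Type*} [Fintype V] [DecidableEq V] {K : TriComplex V}

/-- A point `x ≠ z` from which both sides of a cone with apex `z` are seen through `z` does not lie
in the region of the cone. -/
theorem notMem_coneRegion (hcat : IsCAT0 K.Point) {x y z p q : K.Point}
    (hc : K.IsCone z p q) (hp : z ∈ geodSeg x p) (hq : z ∈ geodSeg x q) (hxz : x ≠ z)
    (hy : y ∈ K.coneRegion z p q) :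
    x ∉ connectedComponentIn (K.coneSides z p q)ᶜ y := by
  intro hx
  obtain ⟨-, -, hpz, hqz, -, hpi⟩ := hc
  obtain ⟨-, ε, hε, hang⟩ := hy
  obtain ⟨G, hG⟩ := hcat.geodesic z x
  obtain ⟨l, g, hl, hg0, hgl, hg, rfl⟩ := id hG
  have hl0 : 0 < l := hl.lt_of_ne fun h' => hxz (by rw [← hgl, ← hg0, ← h'])
  have hbtw : ∀ t ∈ Icc 0 l, rdist x (g t) + rdist (g t) z = rdist x z := fun t ht => by
    have := rdist_add_rdist_of_mem_geodSeg (mem_sUnion.2 ⟨_, hG, t, ht, rfl⟩)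
    rw [rdist_comm x, rdist_comm (g t) z, rdist_comm x]
    linarith
  have hedist : ∀ t ∈ Icc 0 l, edist z (g t) = ENNReal.ofReal t := fun t ht => by
    rw [← hg0, hg 0 ⟨le_rfl, hl⟩ t ht, zero_sub, abs_neg, abs_of_nonneg ht.1]
  have hne : ∀ t ∈ Ioc 0 l, g t ≠ z := fun t ht h => by
    have h1 := hedist t (Ioc_subset_Icc_self ht)
    rw [h, edist_self] at h1
    exact (ENNReal.ofReal_pos.2 ht.1).ne h1
  have hoff : ∀ t ∈ Ioc 0 l, ∀ p', z ∈ geodSeg x p' → g t ∉ geodSeg z p' :=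
    fun t ht p' hp' hmem => by
      have h1 := hcat.rdist_add_eq_of_mem hp' (hbtw t (Ioc_subset_Icc_self ht)) hmem
      rw [rdist_self] at h1
      linarith [hcat.rdist_pos (hne t ht), rdist_nonneg z (g t)]
  have hsub : g '' Ioc 0 l ⊆ (K.coneSides z p q)ᶜ := by
    rintro _ ⟨t, ht, rfl⟩ (h | h)
    exacts [hoff t ht p hp h, hoff t ht q hq h]
  have hreg : g '' Ioc 0 l ⊆ connectedComponentIn (K.coneSides z p q)ᶜ y := by
    rw [connectedComponentIn_eq hx]
    exact (isPreconnected_Ioc.image g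
      ((continuousOn_of_edist_eq hg).mono Ioc_subset_Icc_self)).subset_connectedComponentIn
      ⟨l, ⟨hl0, le_rfl⟩, hgl⟩ hsub
  obtain ⟨δ, hδ, hδε⟩ : ∃ δ : ℝ, 0 < δ ∧ ENNReal.ofReal δ < ε := by
    obtain ⟨δ, h1, h2⟩ := ENNReal.lt_iff_exists_nnreal_btwn.1 hε
    exact ⟨δ, by exact_mod_cast h1, by simpa using h2⟩
  have hm : min δ l ∈ Ioc 0 l := ⟨lt_min hδ hl0, min_le_right _ _⟩
  -- Near the apex the region consists of directions inside the angle, so this applies to `s`.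
  set s := g (min δ l) with hs
  have hmem : s ∈ g '' Ioc 0 l := ⟨_, hm, rfl⟩
  have hin : InAngle z p q s := by
    refine (hang s (hsub hmem) ?_).1 (hreg hmem)
    rw [hs, hedist _ (Ioc_subset_Icc_self hm)]
    exact (ENNReal.ofReal_le_ofReal (min_le_left _ _)).trans_lt hδε
  -- The geodesic from `z` towards `x` prolongs both sides of the cone beyond the apex.
  have hopp : ∀ p', z ∈ geodSeg x p' → ∀ r ∈ geodSeg z p', ∀ t ∈ geodSeg z s,
      rdist t r = rdist z t + rdist z r := fun p' hp' r hr t ht => by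
    have h1 := rdist_add_rdist_of_mem_geodSeg ht
    have h2 := hbtw _ (Ioc_subset_Icc_self hm)
    have h3 := hcat.rdist_triangle x s t
    have h4 := hcat.rdist_triangle x t z
    rw [rdist_comm s z] at h2
    rw [rdist_comm t s] at h1
    rw [rdist_comm t z] at h4
    have h5 := hcat.rdist_add_eq_of_mem (s := t) hp' (by rw [rdist_comm t z]; linarith) hr
    rw [rdist_comm t z] at h5
    exact h5.symm
  have h1 : alexAngle z p s = Real.pi :=
    hcat.alexAngle_eq_pi hpz (hne _ hm) fun r hr t ht => by
      rw [rdist_comm r t, hopp p hp r hr t ht, add_comm]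
  have h2 : alexAngle z s q = Real.pi :=
    hcat.alexAngle_eq_pi (hne _ hm) hqz fun t ht r hr => hopp q hq r hr t ht
  rw [InAngle, h1, h2] at hin
  linarith [Real.pi_pos]

end TriComplex

theorem mainTheorem9 {V : Type*} [Fintype V] [DecidableEq V] (K : TriComplex V)
    (hplanar : K.IsPlanar) (hcat : IsCAT0 K.Point) (x : K.Point)
    (S : Set (K.Point × K.Point × K.Point)) (hS : K.IsSPM x S) (y : K.Point) :
    (∃ z p q, (z, p, q) ∈ S ∧ y ∈ K.cone z p q) ∧
      ∀ z p q, (z, p, q) ∈ S → y ∈ K.cone z p q →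
        ∀ G : Set K.Point, IsGeodesic x y G → z ∈ G := by
  refine ⟨hS.cover y, fun z p q hzS hy G hG => ?_⟩
  obtain ⟨hp, hq⟩ := hS.apex_mem z p q hzS
  obtain ⟨l, g, hl, hg0, hgl, hg, hGeq⟩ := id hG
  have hxG : x ∈ G := hGeq ▸ ⟨0, ⟨le_rfl, hl⟩, hg0⟩
  have hyG : y ∈ G := hGeq ▸ ⟨l, ⟨hl, le_rfl⟩, hgl⟩
  have hside : ∀ s ∈ G, s ∈ K.coneSides z p q → z ∈ G := by
    have hxz : rdist x x + rdist x z = rdist x z := by rw [rdist_self, zero_add]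
    have aux : ∀ p', z ∈ geodSeg x p' → ∀ s ∈ G, s ∈ geodSeg z p' → z ∈ G :=
      fun p' hp' s hs hsz =>
        hcat.mem_of_rdist_add_eq hG hs (hcat.rdist_add_eq_of_mem hp' hxz hsz)
    rintro s hs (h | h)
    exacts [aux p hp s hs h, aux q hq s hs h]
  by_contra hzG
  have hGsub : G ⊆ (K.coneSides z p q)ᶜ := fun s hs h => hzG (hside s hs h)
  have hyR : y ∈ K.coneRegion z p q := hy.resolve_right fun h => hzG (hside y hyG h)
  have hGconn : IsPreconnected G :=
    hGeq ▸ isPreconnected_Icc.image g (continuousOn_of_edist_eq hg)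
  exact TriComplex.notMem_coneRegion hcat (hS.isCone z p q hzS) hp hq (fun h => hzG (h ▸ hxG)) hyR
    (hGconn.subset_connectedComponentIn hyG hGsub hxG)
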